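/- **Notation.** Let $q\in\mathbb N$, $\alpha\in\mathbb R$. Matrices are complex $q\times q$; $B\ge 0$ means that $B$ is Hermitian and nonnegative definite, $\ker B$ is its null space, and $B^{+}$ its Moore–Penrose inverse. For a sequence $(s_j)$ of matrices put $H_n(s)=(s_{j+k})_{j,k=0}^n$ (block Hankel matrix) and $s^{(\alpha)}_j=-\alpha s_j+s_{j+1}$. *Classes.* For $m\in\mathbb N_0$, $\mathcal K^{\ge}_{q,m,\alpha}$ is the set of all $(s_j)_{j=0}^m$ such that: $H_0(s)\ge0$ if $m=0$; $H_n(s)\ge 0$ and $H_{n-1}(s^{(\alpha)})\ge 0$ if $m=2n$, $n\ge1$; $H_n(s)\ge 0$ and $H_n(s^{(\alpha)})\ge0$ if $m=2n+1$. For $m\in\mathbb N_0$, $\mathcal K^{\ge,e}_{q,m,\alpha}$ is the set of all $(s_j)_{j=0}^m$ for which there is a matrix $s_{m+1}$ with $(s_j)_{j=0}^{m+1}\in\mathcal K^{\ge}_{q,m+1,\alpha}$; and $\mathcal K^{\ge,e}_{q,\infty,\alpha}$ is the set of all infinite sequences $(s_j)_{j=0}^\infty$ with $(s_j)_{j=0}^m\in\mathcal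 K^{\ge}_{q,m,\alpha}$ for all $m\in\mathbb N_0$. *Parametrization.* Let $L_0(s)=s_0$ and, for $n\ge1$, $$L_n(s)=s_{2n}-[s_n,\dots,s_{2n-1}]\,H_{n-1}(s)^{+}\begin{bmatrix}s_n\\ \vdots\\ s_{2n-1}\end{bmatrix}.$$ The right $\alpha$-Stieltjes parametrization of $(s_j)_{j=0}^\kappa$ is the sequence $(Q_j)_{j=0}^\kappa$ with $Q_{2k}=L_k(s)$ for $2k\le\kappa$ and $Q_{2k+1}=L_k(s^{(\alpha)})$ for $2k+1\le\kappa$. *Inverse transform.* For a sequence $(t_j)_{j=0}^\kappa$ and a matrix $A$, the inverse $\alpha$-Schur–Stieltjes transform of $[(t_j)_{j=0}^\kappa,A]$ is the sequence $(s_j)_{j=0}^{\kappa+1}$ given recursively by $s_0=A$ and $$s_j=\alpha^jA+\sum_{l=1}^{j}\alpha^{j-l}AA^{+}\Bigl[\sum_{k=0}^{l-1}t_{l-k-1}A^{+}(-\alpha s_{k-1}+s_k)\Bigr]\qquad(1\le j\le\kappa+1),\qquad s_{-1}:=0.$$ **Theorem.** Let $\alpha\in\mathbb R$ and let $A\ge0$.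 (a) Let $\kappa\in\mathbb N_0\cup\{\infty\}$ and let $(t_j)_{j=0}^\kappa\in\mathcal K^{\ge,e}_{q,\kappa,\alpha}$ with $\ker A\subseteq\ker t_0$. Let $(s_j)_{j=0}^{\kappa+1}$ be the inverse $\alpha$-Schur–Stieltjes transform of $[(t_j)_{j=0}^\kappa,A]$, and let $(T_j)_{j=0}^\kappa$ and $(Q_j)_{j=0}^{\kappa+1}$ be the right $\alpha$-Stieltjes parametrizations of $(t_j)_{j=0}^\kappa$ and $(s_j)_{j=0}^{\kappa+1}$. Then $Q_0=A$ and $Q_j=T_{j-1}$ for all integers $j$ with $1\le j\le\kappa+1$. (b) Let $m\in\mathbb N_0$ and let $(t_j)_{j=0}^m\in\mathcal K^{\ge}_{q,m,\alpha}$ with $\ker A\subseteq\ker t_0\cap\ker t_m$. Define $(s_j)_{j=0}^{m+1}$, $(T_j)_{j=0}^m$ and $(Q_j)_{j=0}^{m+1}$ from $(t_j)_{j=0}^m$ and $A$ as in (a), with $\kappa=m$. Then $Q_0=A$ and $Q_j=T_{j-1}$ for all $j\in\{1,\dots,m+1\}$. -/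

import Mathlib

open scoped ComplexOrder

namespace StieltjesSchur

section MoorePenrose

/-- `B` satisfies the four Penrose equations for `A`. -/
structure IsMoorePenrose {m n : Type*} [Fintype m] [Fintype n]
    (A : Matrix m n ℂ) (B : Matrix n m ℂ) : Prop where
  mul_mul_left : A * B * A = A
  mul_mul_right : B * A * B = B
  hermitian_left : (A * B).IsHermitian
  hermitian_right : (B * A).IsHermitian

theorem IsMoorePenrose.unique {m n : Type*} [Fintype m] [Fintype n]
    {A : Matrix m n ℂ} {B C : Matrix n m ℂ}
    (hB : IsMoorePenrose A B) (hC : IsMoorePenrose A C) : B = C := by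
  have h1 : A * B = A * C := by
    calc A * B = (A * C * A) * B := by rw [hC.mul_mul_left]
      _ = (A * C) * (A * B) := by rw [Matrix.mul_assoc]
      _ = (A * C).conjTranspose * (A * B).conjTranspose := by
          rw [hC.hermitian_left.eq, hB.hermitian_left.eq]
      _ = ((A * B * A) * C).conjTranspose := by
          rw [← Matrix.conjTranspose_mul]; simp only [Matrix.mul_assoc]
      _ = A * C := by rw [hB.mul_mul_left, hC.hermitian_left.eq]
  have h2 : B * A = C * A := by
    calc B * A = B * (A * C * A) := by rw [hC.mul_mul_left]
      _ = (B * A) * (C * A) := by simp only [Matrix.mul_assoc]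
      _ = (B * A).conjTranspose * (C * A).conjTranspose := by
          rw [hC.hermitian_right.eq, hB.hermitian_right.eq]
      _ = (C * (A * B * A)).conjTranspose := by
          rw [← Matrix.conjTranspose_mul]; simp only [Matrix.mul_assoc]
      _ = C * A := by rw [hB.mul_mul_left, hC.hermitian_right.eq]
  calc B = B * A * B := hB.mul_mul_right.symm
    _ = C * (A * B) := by rw [h2, Matrix.mul_assoc]
    _ = C * A * C := by rw [h1, Matrix.mul_assoc]
    _ = C := hC.mul_mul_right

theorem exists_isMoorePenrose {m n : Type*} [Fintype m] [Fintype n] (A : Matrix m n ℂ) :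
    ∃ B : Matrix n m ℂ, IsMoorePenrose A B := by
  classical
  have hS : (A.conjTranspose * A).IsHermitian := Matrix.isHermitian_conjTranspose_mul_self A
  set S := A.conjTranspose * A with hSdef
  obtain ⟨G, hGh, hSGS, hGSG, hc⟩ :
      ∃ G : Matrix n n ℂ, G.IsHermitian ∧ S * G * S = S ∧ G * S * G = G ∧ G * S = S * G := by
    set U : Matrix n n ℂ := (hS.eigenvectorUnitary : Matrix n n ℂ) with hU
    set d : n → ℂ := fun i => (hS.eigenvalues i : ℂ) with hd
    have hUU : star U * U = 1 := Unitary.coe_star_mul_self hS.eigenvectorUnitary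
    have hspec : S = U * Matrix.diagonal d * star U := by
      have h := hS.spectral_theorem
      rw [Unitary.conjStarAlgAut_apply] at h
      exact h
    have key : ∀ a b : n → ℂ, (U * Matrix.diagonal a * star U) * (U * Matrix.diagonal b * star U)
        = U * Matrix.diagonal (fun i => a i * b i) * star U := by
      intro a b
      calc _ = U * Matrix.diagonal a * (star U * U) * Matrix.diagonal b * star U := by
            simp only [Matrix.mul_assoc]
        _ = _ := by
            rw [hUU, Matrix.mul_one, Matrix.mul_assoc U, Matrix.diagonal_mul_diagonal]
    refine ⟨U * Matrix.diagonal (fun i => (d i)⁻¹) * star U, ?_, ?_, ?_, ?_⟩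
    · have : star (fun i => (d i)⁻¹) = fun i => (d i)⁻¹ := by
        funext i; simp [hd]
      rw [Matrix.IsHermitian, Matrix.conjTranspose_mul, Matrix.conjTranspose_mul,
        Matrix.diagonal_conjTranspose, this, Matrix.star_eq_conjTranspose,
        Matrix.conjTranspose_conjTranspose, Matrix.mul_assoc]
    · rw [hspec, key, key]
      congr 3; funext i
      exact mul_inv_mul_cancel (d i)
    · rw [hspec, key, key]
      congr 3; funext i
      by_cases h : d i = 0 <;> simp [h]
    · rw [hspec, key, key]
      congr 3; funext i
      exact mul_comm _ _
  have hA : A * (G * S) = A := by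
    have h0 : (A * (G * S) - A).conjTranspose * (A * (G * S) - A) = 0 := by
      have e : (A * (G * S)).conjTranspose = S * G * A.conjTranspose := by
        rw [Matrix.conjTranspose_mul, Matrix.conjTranspose_mul, hS.eq, hGh.eq]
      rw [Matrix.conjTranspose_sub, e, Matrix.sub_mul, Matrix.mul_sub, Matrix.mul_sub]
      have e1 : S * G * A.conjTranspose * (A * (G * S)) = S := by
        calc _ = S * G * S * (G * S) := by rw [hSdef]; simp only [Matrix.mul_assoc]
          _ = S := by rw [hSGS, ← Matrix.mul_assoc, hSGS]
      have e2 : S * G * A.conjTranspose * A = S := by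
        rw [Matrix.mul_assoc, ← hSdef, hSGS]
      have e3 : A.conjTranspose * (A * (G * S)) = S := by
        rw [← Matrix.mul_assoc, ← hSdef, ← Matrix.mul_assoc, hSGS]
      rw [e1, e2, e3, ← hSdef]; simp
    exact sub_eq_zero.1 (Matrix.conjTranspose_mul_self_eq_zero.1 h0)
  refine ⟨G * A.conjTranspose, ?_, ?_, ?_, ?_⟩
  · calc _ = A * (G * S) := by rw [hSdef]; simp only [Matrix.mul_assoc]
      _ = A := hA
  · calc _ = (G * S * G) * A.conjTranspose := by rw [hSdef]; simp only [Matrix.mul_assoc]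
      _ = _ := by rw [hGSG]
  · rw [Matrix.IsHermitian, Matrix.conjTranspose_mul, Matrix.conjTranspose_mul,
      Matrix.conjTranspose_conjTranspose, hGh.eq, Matrix.mul_assoc]
  · rw [Matrix.mul_assoc, ← hSdef, Matrix.IsHermitian, Matrix.conjTranspose_mul, hS.eq, hGh.eq, hc]

/-- The Moore-Penrose inverse `A⁺` of a complex matrix. -/
noncomputable def mpInv {m n : Type*} [Fintype m] [Fintype n] (A : Matrix m n ℂ) :
    Matrix n m ℂ :=
  (exists_isMoorePenrose A).choose

theorem isMoorePenrose_mpInv {m n : Type*} [Fintype m] [Fintype n] (A : Matrix m n ℂ) :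
    IsMoorePenrose A (mpInv A) :=
  (exists_isMoorePenrose A).choose_spec

end MoorePenrose

/- A sequence `(s_j)_{j=0}^κ` of complex `p × q` matrices is represented by a function
`s : ℕ → Matrix (Fin p) (Fin q) ℂ` of which only the values `s j` with `j ≤ κ` matter. -/

section Sequences

/-- The block Hankel matrix `H_n = (s_{j+k})_{j,k=0}^n`. -/
def hankel {p q : ℕ} (s : ℕ → Matrix (Fin p) (Fin q) ℂ) (n : ℕ) :
    Matrix (Fin (n + 1) × Fin p) (Fin (n + 1) × Fin q) ℂ :=
  Matrix.of fun a b => s (a.1 + b.1) a.2 b.2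

/-- The block column `col(s_l, …, s_{l+n})`. -/
def blockCol {p q : ℕ} (s : ℕ → Matrix (Fin p) (Fin q) ℂ) (l n : ℕ) :
    Matrix (Fin (n + 1) × Fin p) (Fin q) ℂ :=
  Matrix.of fun a b => s (l + a.1) a.2 b

/-- The block row `[s_l, …, s_{l+n}]`. -/
def blockRow {p q : ℕ} (s : ℕ → Matrix (Fin p) (Fin q) ℂ) (l n : ℕ) :
    Matrix (Fin p) (Fin (n + 1) × Fin q) ℂ :=
  Matrix.of fun a b => s (l + b.1) a b.2

/-- The right-sided `α`-shift `-α s_j + s_{j+1}`. -/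
def rightShift {p q : ℕ} (α : ℂ) (s : ℕ → Matrix (Fin p) (Fin q) ℂ) :
    ℕ → Matrix (Fin p) (Fin q) ℂ :=
  fun j => -(α • s j) + s (j + 1)

/-- The sequence `-α s_{j-1} + s_j` with the convention `s_{-1} = 0`. -/
def plusTransform {p q : ℕ} (α : ℂ) (s : ℕ → Matrix (Fin p) (Fin q) ℂ) :
    ℕ → Matrix (Fin p) (Fin q) ℂ
  | 0 => s 0
  | j + 1 => -(α • s j) + s (j + 1)

/-- The Schur complements `L_0 = s_0` and
`L_n = s_{2n} - [s_n, …, s_{2n-1}] (H_{n-1})⁺ col(s_n, …, s_{2n-1})` for `n ≥ 1`. -/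
noncomputable def schurL {p q : ℕ} (s : ℕ → Matrix (Fin p) (Fin q) ℂ) :
    ℕ → Matrix (Fin p) (Fin q) ℂ
  | 0 => s 0
  | n + 1 =>
      s (2 * (n + 1)) - blockRow s (n + 1) n * mpInv (hankel s n) * blockCol s (n + 1) n

/-- The right `α`-Stieltjes parametrization `(Q_j)` of `(s_j)`: `Q_{2k}` is the matrix `L_k` of
`(s_j)`, and `Q_{2k+1}` is the matrix `L_k` of `(-α s_j + s_{j+1})`. The matrix `Q_j` depends only
on `s_0, …, s_j`. -/
noncomputable def stieltjesParam {p q : ℕ} (α : ℂ) (s : ℕ → Matrix (Fin p) (Fin q) ℂ) (j : ℕ) :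
    Matrix (Fin p) (Fin q) ℂ :=
  if Even j then schurL s (j / 2) else schurL (rightShift α s) (j / 2)

theorem stieltjesParam_even {p q : ℕ} (α : ℂ) (s : ℕ → Matrix (Fin p) (Fin q) ℂ) (k : ℕ) :
    stieltjesParam α s (2 * k) = schurL s k := by
  simp [stieltjesParam]

theorem stieltjesParam_odd {p q : ℕ} (α : ℂ) (s : ℕ → Matrix (Fin p) (Fin q) ℂ) (k : ℕ) :
    stieltjesParam α s (2 * k + 1) = schurL (rightShift α s) k := by
  have : (2 * k + 1) / 2 = k := by omega
  simp [stieltjesParam, this]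

/-- The inverse `α`-Schur-Stieltjes transform of `[(t_j), A]`. The term of index `j` depends
only on `A` and `t_0, …, t_{j-1}`. The recursion in its customary indexing is
`invTransform_eq`. -/
noncomputable def invTransform {p q : ℕ} (α : ℂ) (t : ℕ → Matrix (Fin p) (Fin q) ℂ)
    (A : Matrix (Fin p) (Fin q) ℂ) : ℕ → Matrix (Fin p) (Fin q) ℂ
  | 0 => A
  | j + 1 => α ^ (j + 1) • A + ∑ l : Fin (j + 1), α ^ (j - l.1) • (A * mpInv A *
      ∑ k : Fin (l.1 + 1), t (l.1 - k.1) * mpInv A *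
        (if k.1 = 0 then invTransform α t A k.1
          else -(α • invTransform α t A (k.1 - 1)) + invTransform α t A k.1))
  decreasing_by all_goals (have := l.2; have := k.2; omega)

theorem invTransform_zero {p q : ℕ} (α : ℂ) (t : ℕ → Matrix (Fin p) (Fin q) ℂ)
    (A : Matrix (Fin p) (Fin q) ℂ) : invTransform α t A 0 = A := by
  rw [invTransform]

theorem invTransform_eq {p q : ℕ} (α : ℂ) (t : ℕ → Matrix (Fin p) (Fin q) ℂ)
    (A : Matrix (Fin p) (Fin q) ℂ) (j : ℕ) (hj : 1 ≤ j) :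
    invTransform α t A j = α ^ j • A + ∑ l ∈ Finset.Icc 1 j, α ^ (j - l) • (A * mpInv A *
      ∑ k ∈ Finset.range l,
        t (l - k - 1) * mpInv A * plusTransform α (invTransform α t A) k) := by
  obtain ⟨j, rfl⟩ : ∃ i, j = i + 1 := ⟨j - 1, by omega⟩
  rw [invTransform]
  congr 1
  rw [Fin.sum_univ_eq_sum_range (fun l => α ^ (j - l) • (A * mpInv A *
      ∑ k : Fin (l + 1), t (l - k.1) * mpInv A *
        (if k.1 = 0 then invTransform α t A k.1
          else -(α • invTransform α t A (k.1 - 1)) + invTransform α t A k.1))) (j + 1),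
    Finset.range_eq_Ico, ← Finset.Ico_add_one_right_eq_Icc,
    Finset.sum_Ico_eq_sum_range _ 1 (j + 1 + 1), ← Finset.range_eq_Ico]
  refine Finset.sum_congr rfl fun l hl => ?_
  have e : j + 1 - (1 + l) = j - l := by omega
  rw [e, Fin.sum_univ_eq_sum_range (fun k => t (l - k) * mpInv A *
        (if k = 0 then invTransform α t A k
          else -(α • invTransform α t A (k - 1)) + invTransform α t A k)) (l + 1), add_comm 1 l]
  refine congrArg _ (congrArg _ (Finset.sum_congr rfl fun k hk => ?_))
  have e : l + 1 - k - 1 = l - k := by omega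
  rw [e]
  cases k <;> simp [plusTransform]

/-- The class `K^≥_{q,m,α}` of `α`-Stieltjes-nonnegative definite sequences `(s_j)_{j=0}^m`,
`m` finite: with `H_n` built from `(s_j)` and `H^α_n` built from `(-α s_j + s_{j+1})`, this asks
for `H_0 ≥ 0` if `m = 0`, for `H_n ≥ 0` and `H^α_{n-1} ≥ 0` if `m = 2n` with `n ≥ 1`, and for
`H_n ≥ 0` and `H^α_n ≥ 0` if `m = 2n + 1`. -/
def IsStieltjesNonneg {q : ℕ} (α : ℝ) (m : ℕ) (s : ℕ → Matrix (Fin q) (Fin q) ℂ) : Prop :=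
  (hankel s (m / 2)).PosSemidef ∧
    (1 ≤ m → (hankel (rightShift (α : ℂ) s) ((m - 1) / 2)).PosSemidef)

theorem isStieltjesNonneg_zero {q : ℕ} (α : ℝ) (s : ℕ → Matrix (Fin q) (Fin q) ℂ) :
    IsStieltjesNonneg α 0 s ↔ (hankel s 0).PosSemidef := by
  simp [IsStieltjesNonneg]

theorem isStieltjesNonneg_even {q : ℕ} (α : ℝ) (s : ℕ → Matrix (Fin q) (Fin q) ℂ) (n : ℕ) :
    IsStieltjesNonneg α (2 * (n + 1)) s ↔
      (hankel s (n + 1)).PosSemidef ∧ (hankel (rightShift (α : ℂ) s) n).PosSemidef := by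
  have h : (2 * (n + 1) - 1) / 2 = n := by omega
  have h' : 1 ≤ 2 * (n + 1) := by omega
  have h'' : 2 * (n + 1) / 2 = n + 1 := by omega
  rw [IsStieltjesNonneg, h, h'']
  simp only [h', true_imp_iff]

theorem isStieltjesNonneg_odd {q : ℕ} (α : ℝ) (s : ℕ → Matrix (Fin q) (Fin q) ℂ) (n : ℕ) :
    IsStieltjesNonneg α (2 * n + 1) s ↔
      (hankel s n).PosSemidef ∧ (hankel (rightShift (α : ℂ) s) n).PosSemidef := by
  have h : (2 * n + 1) / 2 = n := by omega
  have h' : (2 * n + 1 - 1) / 2 = n := by omega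
  have h'' : 1 ≤ 2 * n + 1 := by omega
  rw [IsStieltjesNonneg, h, h']
  simp only [h'', true_imp_iff]

/-- The class `K^{≥,e}_{q,κ,α}`, `κ ∈ ℕ₀ ∪ {∞}`, of `α`-Stieltjes-nonnegative definite extendable
sequences: for finite `κ = m`, some choice of a further matrix `s_{m+1}` gives a sequence in
`K^≥_{q,m+1,α}`; for `κ = ∞`, all finite sections are in `K^≥_{q,m,α}`. -/
def IsStieltjesNonnegExt {q : ℕ} (α : ℝ) (κ : ℕ∞) (s : ℕ → Matrix (Fin q) (Fin q) ℂ) : Prop :=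
  match κ with
  | (m : ℕ) => ∃ X : Matrix (Fin q) (Fin q) ℂ,
      IsStieltjesNonneg α (m + 1) (Function.update s (m + 1) X)
  | ⊤ => ∀ m : ℕ, IsStieltjesNonneg α m s

theorem isStieltjesNonnegExt_coe {q : ℕ} (α : ℝ) (m : ℕ) (s : ℕ → Matrix (Fin q) (Fin q) ℂ) :
    IsStieltjesNonnegExt α (m : ℕ∞) s ↔ ∃ X : Matrix (Fin q) (Fin q) ℂ,
      IsStieltjesNonneg α (m + 1) (Function.update s (m + 1) X) :=
  Iff.rfl

theorem isStieltjesNonnegExt_top {q : ℕ} (α : ℝ) (s : ℕ → Matrix (Fin q) (Fin q) ℂ) :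
    IsStieltjesNonnegExt α ⊤ s ↔ ∀ m : ℕ, IsStieltjesNonneg α m s :=
  Iff.rfl

end Sequences

end StieltjesSchur

/-! Let `B = A⁺` and let S, T, P be the generating series of s, t and of `plusTransform s`, so P =
(1 - αX)S. The inverse transform says P = A + X·T·B·P, and dividing by 1 - αX gives (1 - αX)S = A +
X·t₀·B·S + X²·T^α·B·S, where T^α belongs to the shifted sequence of t. Transposing gives the
mirrored recursions, since the terms of P and S are Hermitian.

Comparing the two versions factors the block Hankel matrices: that of the shifted s is (lower
Toeplitz)·H(t)·(upper Toeplitz), and that of s is a similar product around H(t^α), bordered by the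
term s_j·B·s_k (`hankel_factorization_shift`, `hankel_factorization`). The Toeplitz factors have
diagonal `A * A⁺` or `A⁺ * A`, projections that t absorbs because of the kernel conditions, so they
act as if unipotent.

Such factors preserve Schur complements. To avoid computing with Moore–Penrose inverses, L_n is
characterized by solvability of H_n x = (0, …, 0, L) with last entry of x equal to 1
(`HasHankelPivot`). Positivity supplies such an x for t or t^α; triangular systems carry it over to
s (`HasHankelPivot.shift`, `HasHankelPivot.succ`), and `schurL_eq_of_hasHankelPivot` reads off L_n.
Thus odd parameters of s come from even ones of t, and even ones from odd ones. -/

namespace StieltjesSchur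

/-! ### Triangular Toeplitz factorizations of Hankel matrices over a ring -/

section Toeplitz

variable {R : Type*} [Ring R]

/-- Unipotent upper triangular Toeplitz systems are solvable. -/
theorem exists_toeplitz_solution (h : ℕ → R) (h0 : h 0 = 1) (n : ℕ) (x : ℕ → R) :
    ∃ y : ℕ → R, ∀ b ≤ n, ∑ i ∈ Finset.range (n + 1 - b), h i * y (b + i) = x b := by
  induction n generalizing x with
  | zero =>
    refine ⟨x, fun b hb => ?_⟩
    obtain rfl : b = 0 := by omega
    simp [h0]
  | succ n ih =>
    obtain ⟨y, hy⟩ := ih fun b => x (b + 1)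
    -- Back substitution: the solution of the tail is kept and the new first entry is forced by `h 0
    -- = 1`.
    refine ⟨fun k => Nat.casesOn k (x 0 - ∑ i ∈ Finset.range (n + 1), h (i + 1) * y i) y,
      fun b hb => ?_⟩
    cases b with
    | zero =>
      rw [Nat.sub_zero, Finset.sum_range_succ']
      simp [h0]
    | succ b =>
      rw [← hy b (by omega), show n + 1 + 1 - (b + 1) = n + 1 - b by omega]
      refine Finset.sum_congr rfl fun i _ => ?_
      rw [show b + 1 + i = (b + i) + 1 by omega]

theorem sum_range_sum_range_sub (n : ℕ) (f : ℕ → ℕ → R) :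
    ∑ k ∈ Finset.range n, ∑ b ∈ Finset.range (k + 1), f b (k - b) =
      ∑ b ∈ Finset.range n, ∑ i ∈ Finset.range (n - b), f b i := by
  induction n with
  | zero => simp
  | succ n ih =>
    rw [Finset.sum_range_succ, ih, Finset.sum_range_succ, Finset.sum_range_succ _ n]
    have : ∑ b ∈ Finset.range n, ∑ i ∈ Finset.range (n + 1 - b), f b i =
        ∑ b ∈ Finset.range n, (∑ i ∈ Finset.range (n - b), f b i + f b (n - b)) := by
      refine Finset.sum_congr rfl fun b hb => ?_
      rw [show n + 1 - b = (n - b) + 1 by have := Finset.mem_range.1 hb; omega,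
        Finset.sum_range_succ]
    rw [this, Finset.sum_add_distrib]
    simp [add_assoc]

/-- A Hankel system that factors through triangular Toeplitz matrices. -/
theorem hankel_toeplitz_mul {t g h x y : ℕ → R} {n : ℕ}
    (hy : ∀ b ≤ n, ∑ i ∈ Finset.range (n + 1 - b), h i * y (b + i) = x b) (j : ℕ) :
    ∑ k ∈ Finset.range (n + 1), (∑ a ∈ Finset.range (j + 1), ∑ b ∈ Finset.range (k + 1),
        g (j - a) * t (a + b) * h (k - b)) * y k =
      ∑ a ∈ Finset.range (j + 1), g (j - a) *
        ∑ b ∈ Finset.range (n + 1), t (a + b) * x b := by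
  simp only [Finset.sum_mul]
  rw [Finset.sum_comm]
  refine Finset.sum_congr rfl fun a _ => ?_
  rw [Finset.mul_sum]
  have := sum_range_sum_range_sub (n + 1)
    fun b i => g (j - a) * t (a + b) * h i * y (b + i)
  calc _ = _ := Finset.sum_congr rfl fun k _ => Finset.sum_congr rfl fun b hb => by
        rw [show k = b + (k - b) by have := Finset.mem_range.1 hb; omega]
        simp only [Nat.add_sub_cancel_left]
    _ = _ := this
    _ = _ := Finset.sum_congr rfl fun b hb => by
        rw [← hy b (by have := Finset.mem_range.1 hb; omega), Finset.mul_sum, Finset.mul_sum]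
        simp only [mul_assoc]

/-- Moving one unit of index from k to j leaves the left side unchanged. On the right the two double
sums share all terms except one border each; by `hr` and `hl` both borders equal `p (j + 1) * B * p
(k + 1)`. -/
theorem hankel_factorization_shift {t p : ℕ → R} {B : R}
    (hl : ∀ k, p (k + 1) = ∑ b ∈ Finset.range (k + 1), t b * (B * p (k - b)))
    (hr : ∀ k, p (k + 1) = ∑ a ∈ Finset.range (k + 1), p (k - a) * B * t a)
    (h0 : ∀ k, p 0 * B * t k = t k) (j k : ℕ) :
    p (j + k + 1) = ∑ a ∈ Finset.range (j + 1), ∑ b ∈ Finset.range (k + 1),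
        p (j - a) * B * t (a + b) * (B * p (k - b)) := by
  induction j generalizing k with
  | zero => simp [h0, hl]
  | succ j ih =>
    rw [show j + 1 + k + 1 = j + (k + 1) + 1 by omega, ih, Finset.sum_range_succ' _ (j + 1)]
    simp only [Finset.sum_range_succ' _ (k + 1), Finset.sum_add_distrib]
    congr 1
    · refine Finset.sum_congr rfl fun a _ => Finset.sum_congr rfl fun b _ => ?_
      rw [show a + (b + 1) = a + 1 + b by omega, Nat.add_sub_add_right, Nat.add_sub_add_right]
    · simp only [add_zero, zero_add, Nat.sub_zero, mul_assoc (p (j + 1) * B)]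
      rw [← Finset.mul_sum, ← Finset.sum_mul, ← hl, ← hr, mul_assoc]

/-- The same border comparison; the contributions of `c` and `D` are symmetric in j and k and
therefore cancel. In the application `τ` is the shifted t and `D` is `t 0`. -/
theorem hankel_factorization {𝕜 : Type*} [CommRing 𝕜] [Algebra 𝕜 R] {c : 𝕜} {τ s : ℕ → R}
    {B D : R}
    (hl : ∀ k, ∑ b ∈ Finset.range k, τ b * (B * s (k - 1 - b)) =
      s (k + 1) - c • s k - D * (B * s k))
    (hr : ∀ j, ∑ a ∈ Finset.range j, s (j - 1 - a) * B * τ a =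
      s (j + 1) - c • s j - s j * B * D)
    (h0 : ∀ k, s 0 * B * s k = s k) (j k : ℕ) :
    s (j + k) = s j * (B * s k) + ∑ a ∈ Finset.range j, ∑ b ∈ Finset.range k,
        s (j - 1 - a) * B * τ (a + b) * (B * s (k - 1 - b)) := by
  induction j generalizing k with
  | zero => simp [h0, ← mul_assoc]
  | succ j ih =>
    rw [show j + 1 + k = j + (k + 1) by omega, ih, Finset.sum_range_succ' _ j]
    simp only [Finset.sum_range_succ' _ k, Finset.sum_add_distrib]
    have e1 : ∑ b ∈ Finset.range k, s (j + 1 - 1 - 0) * B * τ (0 + b) * (B * s (k - 1 - b)) =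
        s j * B * (s (k + 1) - c • s k - D * (B * s k)) := by
      simp only [zero_add, add_tsub_cancel_right, Nat.sub_zero, mul_assoc (s j * B)]
      rw [← Finset.mul_sum, hl]
    have e2 : ∑ a ∈ Finset.range j, s (j - 1 - a) * B * τ (a + 0) * (B * s (k + 1 - 1 - 0)) =
        (s (j + 1) - c • s j - s j * B * D) * (B * s k) := by
      simp only [add_zero, add_tsub_cancel_right, Nat.sub_zero]
      rw [← Finset.sum_mul, hr]
    have e3 : ∑ a ∈ Finset.range j, ∑ b ∈ Finset.range k,
          s (j - 1 - a) * B * τ (a + (b + 1)) * (B * s (k + 1 - 1 - (b + 1))) =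
        ∑ a ∈ Finset.range j, ∑ b ∈ Finset.range k,
          s (j + 1 - 1 - (a + 1)) * B * τ (a + 1 + b) * (B * s (k - 1 - b)) :=
      Finset.sum_congr rfl fun a _ => Finset.sum_congr rfl fun b _ => by
        rw [show a + (b + 1) = a + 1 + b by omega, show k + 1 - 1 - (b + 1) = k - 1 - b by omega,
          show j + 1 - 1 - (a + 1) = j - 1 - a by omega]
    rw [e1, e2, e3]
    simp only [mul_sub, sub_mul, mul_assoc, smul_mul_assoc, mul_smul_comm]
    abel

/-- The block Hankel matrix `(s_{j+k})_{j,k=0}^n` maps some block column with last entry `1` to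
the block column `(0, …, 0, L)`. -/
def HasHankelPivot (s : ℕ → R) (n : ℕ) (L : R) : Prop :=
  ∃ x : ℕ → R, x n = 1 ∧
    ∀ j ≤ n, ∑ k ∈ Finset.range (n + 1), s (j + k) * x k = if j = n then L else 0

/-- Allows the projection on the diagonal of the right Toeplitz factor to be replaced by 1, which
makes that factor invertible. -/
theorem mul_update_zero_one {h : ℕ → R} {u : R} (hu : u * h 0 = u) (k : ℕ) :
    u * Function.update h 0 1 k = u * h k := by
  cases k <;> simp [hu]

theorem HasHankelPivot.shift {t p : ℕ → R} {B L : R} {n : ℕ}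
    (hl : ∀ k, p (k + 1) = ∑ b ∈ Finset.range (k + 1), t b * (B * p (k - b)))
    (hr : ∀ k, p (k + 1) = ∑ a ∈ Finset.range (k + 1), p (k - a) * B * t a)
    (h0 : ∀ k, p 0 * B * t k = t k) (h1 : ∀ k, t k * (B * p 0) = t k)
    (ht : HasHankelPivot t n L) : HasHankelPivot (fun k => p (k + 1)) n L := by
  obtain ⟨x, hx, hL⟩ := ht
  -- The right factor takes y to x, so the product applied to y is the left factor applied to (0, …,
  -- 0, L). Lower triangularity leaves only the last entry, `p 0 * B * L = L`.
  obtain ⟨y, hy⟩ := exists_toeplitz_solution (Function.update (fun k => B * p k) 0 1)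
    (by simp) n x
  refine ⟨y, by simpa [hx] using hy n le_rfl, fun j hj => ?_⟩
  have key := hankel_toeplitz_mul (t := t) (g := fun k => p k * B) hy j
  have hL0 : p 0 * B * L = L := by
    have := hL n le_rfl
    rw [if_pos rfl] at this
    rw [← this, Finset.mul_sum]
    simp only [← mul_assoc, h0]
  have e : ∀ k, p (j + k + 1) = ∑ a ∈ Finset.range (j + 1), ∑ b ∈ Finset.range (k + 1),
      p (j - a) * B * t (a + b) * Function.update (fun k => B * p k) 0 1 (k - b) := fun k => by
    rw [hankel_factorization_shift hl hr h0]
    refine Finset.sum_congr rfl fun a _ => Finset.sum_congr rfl fun b _ => ?_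
    rw [mul_update_zero_one (by rw [mul_assoc, h1])]
  simp only [e, key]
  rw [Finset.sum_congr rfl fun a ha => by rw [hL a (by have := Finset.mem_range.1 ha; omega)]]
  rw [Finset.sum_range_succ, Finset.sum_eq_zero fun a ha => by
    rw [if_neg (by have := Finset.mem_range.1 ha; omega), mul_zero]]
  split_ifs with h <;> simp [hL0]

theorem HasHankelPivot.succ {𝕜 : Type*} [CommRing 𝕜] [Algebra 𝕜 R] {c : 𝕜} {τ s : ℕ → R}
    {B D L : R} {n : ℕ}
    (hl : ∀ k, ∑ b ∈ Finset.range k, τ b * (B * s (k - 1 - b)) =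
      s (k + 1) - c • s k - D * (B * s k))
    (hr : ∀ j, ∑ a ∈ Finset.range j, s (j - 1 - a) * B * τ a =
      s (j + 1) - c • s j - s j * B * D)
    (h0 : ∀ k, s 0 * B * s k = s k) (h1 : ∀ k, s k * (B * s 0) = s k)
    (h0' : ∀ k, s 0 * B * τ k = τ k) (h1' : ∀ k, τ k * (B * s 0) = τ k)
    (hτ : HasHankelPivot τ n L) : HasHankelPivot s (n + 1) L := by
  obtain ⟨x, hx, hL⟩ := hτ
  set h : ℕ → R := Function.update (fun k => B * s k) 0 1 with hh
  -- The right-hand side is (0, x): its leading zero annihilates the border term `s j * (B * s k)`,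
  -- and the remaining equations reproduce x.
  obtain ⟨y, hy⟩ := exists_toeplitz_solution h (by simp [hh]) (n + 1)
    fun k => Nat.casesOn k 0 x
  have hy0 : ∑ i ∈ Finset.range (n + 1 + 1), h i * y i = 0 := by
    simpa using hy 0 (by omega)
  have hy' : ∀ b ≤ n, ∑ i ∈ Finset.range (n + 1 - b), h i * y (b + i + 1) = x b := by
    intro b hb
    have := hy (b + 1) (by omega)
    simp only at this
    rw [← this, show n + 1 + 1 - (b + 1) = n + 1 - b by omega]
    exact Finset.sum_congr rfl fun i _ => by rw [show b + 1 + i = b + i + 1 by omega]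
  refine ⟨y, by simpa [hh, hx] using hy' n le_rfl, fun j hj => ?_⟩
  have e : ∀ k, s (j + k) = s j * h k + ∑ a ∈ Finset.range j, ∑ b ∈ Finset.range k,
      s (j - 1 - a) * B * τ (a + b) * h (k - 1 - b) := fun k => by
    rw [hankel_factorization hl hr h0, hh, mul_update_zero_one (h1 j)]
    congr 1
    refine Finset.sum_congr rfl fun a _ => Finset.sum_congr rfl fun b _ => ?_
    rw [mul_update_zero_one (by rw [mul_assoc, h1'])]
  simp only [e, add_mul, Finset.sum_add_distrib]
  simp only [mul_assoc (s j)]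
  rw [← Finset.mul_sum, hy0, mul_zero, zero_add, Finset.sum_range_succ']
  cases j with
  | zero => simp
  | succ j =>
    have key := hankel_toeplitz_mul (t := τ) (g := fun k => s k * B) (h := h) (y := fun k => y (k + 1)) hy' j
    simp only [add_tsub_cancel_right, Finset.range_zero, Finset.sum_empty, zero_mul,
      Finset.sum_const_zero, add_zero, key]
    have hL0 : s 0 * B * L = L := by
      have := hL n le_rfl
      rw [if_pos rfl] at this
      rw [← this, Finset.mul_sum]
      simp only [← mul_assoc, h0']
    rw [Finset.sum_congr rfl fun a ha => by rw [hL a (by have := Finset.mem_range.1 ha; omega)]]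
    rw [Finset.sum_range_succ, Finset.sum_eq_zero fun a ha => by
      rw [if_neg (by have := Finset.mem_range.1 ha; omega), mul_zero]]
    by_cases h : j = n <;> simp [h, hL0]

open PowerSeries in
/-- The left and the right resolvent recursion have the same solution. -/
theorem resolvent_left_eq_right {t p p' : ℕ → R} {B : R}
    (hl : ∀ k, p (k + 1) = ∑ b ∈ Finset.range (k + 1), t b * (B * p (k - b)))
    (hr : ∀ k, p' (k + 1) = ∑ a ∈ Finset.range (k + 1), p' (k - a) * B * t a)
    (hp : p' 0 = p 0) (h0 : ∀ k, p 0 * B * p k = p k) (h1 : ∀ k, p' k * B * p 0 = p' k) :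
    p' = p := by
  have hP : mk p = C (p 0) + X * (mk t * (C B * mk p)) := by
    ext k
    cases k with
    | zero => simp
    | succ k =>
      rw [coeff_mk, hl, map_add, coeff_succ_X_mul, coeff_succ_C, zero_add, PowerSeries.coeff_mul,
        Finset.Nat.sum_antidiagonal_eq_sum_range_succ_mk]
      simp only [coeff_C_mul, coeff_mk]
  have hP' : mk p' = C (p 0) + X * (mk p' * C B * mk t) := by
    ext k
    cases k with
    | zero => simp [hp]
    | succ k =>
      rw [coeff_mk, hr, ← Finset.sum_range_reflect]
      rw [map_add, coeff_succ_X_mul, coeff_succ_C, zero_add, PowerSeries.coeff_mul,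
        Finset.Nat.sum_antidiagonal_eq_sum_range_succ_mk]
      refine Finset.sum_congr rfl fun i hi => ?_
      have hi' := Finset.mem_range.1 hi
      rw [coeff_mul_C, coeff_mk, coeff_mk, show k + 1 - 1 - i = k - i by omega,
        Nat.sub_sub_self (by omega)]
  -- The product P'·B·P is expanded twice, through the recursion of P and through that of P'; the
  -- correction terms coincide and cancel.
  have e1 : mk p' * C B * mk p = mk p' + X * (mk p' * C B * mk t * (C B * mk p)) := by
    have : mk p' * C B * C (p 0) = mk p' := by
      ext k; simp [coeff_mul_C, h1]
    conv_lhs => rw [hP, mul_add, this, ← mul_assoc, ← X_mul]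
    simp only [mul_assoc]
  have e2 : mk p' * C B * mk p = mk p + X * (mk p' * C B * mk t * (C B * mk p)) := by
    have : C (p 0) * (C B * mk p) = mk p := by
      ext k; rw [coeff_C_mul, coeff_C_mul, coeff_mk, ← mul_assoc, h0]
    conv_lhs => rw [hP', mul_assoc, add_mul, this]
    simp only [mul_assoc]
  have e : mk p' = mk p := add_right_cancel (e1.symm.trans e2)
  funext k
  simpa using congrArg (coeff k) e

end Toeplitz

/-! ### Moore–Penrose inverses: Hermitian matrices and kernel inclusions -/

section MoorePenroseHermitian

variable {n : Type*} [Fintype n]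

theorem mpInv_isHermitian {A : Matrix n n ℂ} (hA : A.IsHermitian) : (mpInv A).IsHermitian := by
  have h := isMoorePenrose_mpInv A
  refine IsMoorePenrose.unique (A := A) ⟨?_, ?_, ?_, ?_⟩ h
  · simpa [hA.eq, Matrix.mul_assoc] using congrArg Matrix.conjTranspose h.mul_mul_left
  · simpa [hA.eq, Matrix.mul_assoc] using congrArg Matrix.conjTranspose h.mul_mul_right
  · have := h.hermitian_right
    rw [Matrix.IsHermitian, Matrix.conjTranspose_mul, hA.eq] at this
    rw [this]; exact h.hermitian_right
  · have := h.hermitian_left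
    rw [Matrix.IsHermitian, Matrix.conjTranspose_mul, hA.eq] at this
    rw [this]; exact h.hermitian_left

/-- `T A⁺ A = T` if the null space of `A` is contained in that of `T`. -/
theorem mul_mpInv_mul_of_ker {m p : Type*} [Fintype m] {A : Matrix m n ℂ}
    {T : Matrix p n ℂ} (h : ∀ v, A.mulVec v = 0 → T.mulVec v = 0) : T * (mpInv A * A) = T := by
  classical
  -- The columns of `1 - mpInv A * A` lie in the kernel of `A`.
  have hz : T * (1 - mpInv A * A) = 0 := by
    refine Matrix.ext_of_mulVec_single fun i => ?_
    rw [← Matrix.mulVec_mulVec, Matrix.zero_mulVec]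
    apply h
    rw [Matrix.mulVec_mulVec, Matrix.mul_sub, ← Matrix.mul_assoc,
      (isMoorePenrose_mpInv A).mul_mul_left, Matrix.mul_one, sub_self, Matrix.zero_mulVec]
  rw [Matrix.mul_sub, Matrix.mul_one] at hz
  exact (sub_eq_zero.1 hz).symm

end MoorePenroseHermitian

/-! ### Block Hankel matrices: Schur complements as pivots, and null spaces -/

section Hankel

variable {q : ℕ} {s : ℕ → Matrix (Fin q) (Fin q) ℂ} {n : ℕ}

theorem hankel_mul_blockCol (s x : ℕ → Matrix (Fin q) (Fin q) ℂ) (n : ℕ) :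
    hankel s n * blockCol x 0 n =
      blockCol (fun j => ∑ k ∈ Finset.range (n + 1), s (j + k) * x k) 0 n := by
  ext ⟨a, i⟩ b
  simp only [hankel, blockCol, Matrix.mul_apply, Matrix.of_apply, Fintype.sum_prod_type, zero_add,
    Matrix.sum_apply]
  rw [Finset.sum_range]

theorem blockRow_mul_blockCol (s x : ℕ → Matrix (Fin q) (Fin q) ℂ) (l n : ℕ) :
    blockRow s l n * blockCol x 0 n = ∑ k ∈ Finset.range (n + 1), s (l + k) * x k := by
  ext i b
  simp only [blockRow, blockCol, Matrix.mul_apply, Matrix.of_apply, Fintype.sum_prod_type,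
    zero_add, Matrix.sum_apply]
  rw [Finset.sum_range]

theorem blockCol_conjTranspose (hs : ∀ j, (s j).IsHermitian) (l n : ℕ) :
    (blockCol s l n).conjTranspose = blockRow s l n := by
  ext i ⟨a, b⟩
  simpa [blockCol, blockRow] using (hs (l + a)).apply i b

theorem hankel_isHermitian (hs : ∀ j, (s j).IsHermitian) (n : ℕ) : (hankel s n).IsHermitian := by
  ext ⟨a, i⟩ ⟨b, j⟩
  simpa [hankel, add_comm] using (hs (a + b)).apply i j

/-- With x the upper part of the pivot column, the block column is -Hx and, by Hermitian symmetry,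
the block row is -x*H. Then H·H⁺·H = H removes the Moore–Penrose inverse, whichever x was chosen. -/
theorem schurL_eq_of_hasHankelPivot (hs : ∀ j, (s j).IsHermitian)
    {L : Matrix (Fin q) (Fin q) ℂ} (h : HasHankelPivot s n L) : schurL s n = L := by
  obtain ⟨x, hx, hL⟩ := h
  cases n with
  | zero => simpa [schurL, hx] using hL 0 le_rfl
  | succ n =>
    have hcol : blockCol s (n + 1) n = -(hankel s n * blockCol x 0 n) := by
      rw [hankel_mul_blockCol]
      ext ⟨a, i⟩ b
      have := hL a (by omega)
      rw [if_neg (by omega), Finset.sum_range_succ, hx, mul_one] at this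
      simp only [blockCol, Matrix.of_apply, Matrix.neg_apply, zero_add, add_comm (n + 1)]
      rw [eq_neg_of_add_eq_zero_right this, Matrix.neg_apply]
    have hrow : blockRow s (n + 1) n = -((blockCol x 0 n).conjTranspose * hankel s n) := by
      rw [← blockCol_conjTranspose hs, hcol, Matrix.conjTranspose_neg, Matrix.conjTranspose_mul,
        (hankel_isHermitian hs n).eq]
    have hmid : blockRow s (n + 1) n * mpInv (hankel s n) * blockCol s (n + 1) n =
        -(blockRow s (n + 1) n * blockCol x 0 n) := by
      rw [hcol, hrow]
      simp only [Matrix.neg_mul, Matrix.mul_neg, neg_neg]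
      rw [Matrix.mul_assoc _ (hankel s n) (mpInv _), Matrix.mul_assoc,
        ← Matrix.mul_assoc _ (hankel s n), (isMoorePenrose_mpInv (hankel s n)).mul_mul_left,
        Matrix.mul_assoc]
    have := hL (n + 1) le_rfl
    rw [if_pos rfl, Finset.sum_range_succ, hx, mul_one] at this
    rw [schurL, hmid, blockRow_mul_blockCol, sub_neg_eq_add, ← this, add_comm, two_mul]

theorem hankel_mulVec (s : ℕ → Matrix (Fin q) (Fin q) ℂ) (n : ℕ)
    (w : Fin (n + 1) × Fin q → ℂ) (a : Fin (n + 1)) (i : Fin q) :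
    (hankel s n).mulVec w (a, i) =
      ∑ b : Fin (n + 1), (s (a + b)).mulVec (fun k => w (b, k)) i := by
  simp [Matrix.mulVec, dotProduct, hankel, Fintype.sum_prod_type]

theorem hankel_posSemidef_of_le {m : ℕ} (h : (hankel s n).PosSemidef) (hm : m ≤ n) :
    (hankel s m).PosSemidef :=
  h.submatrix (Prod.map (Fin.castLE (Nat.succ_le_succ hm)) id)

theorem isHermitian_of_hankel_posSemidef (h : (hankel s n).PosSemidef) {j : ℕ}
    (hj : j ≤ 2 * n) : (s j).IsHermitian := by
  ext a b
  have := h.isHermitian.apply (⟨j / 2, by omega⟩, a) (⟨j - j / 2, by omega⟩, b)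
  simpa [hankel, show j - j / 2 + j / 2 = j by omega, show j / 2 + (j - j / 2) = j by omega]
    using this

/-- Padding w with a zero block gives a vector on which the larger quadratic form vanishes;
positivity puts it in the kernel, and the last block of that equation is the claim. -/
theorem blockRow_mulVec_eq_zero_of_hankel (h : (hankel s (n + 1)).PosSemidef)
    {w : Fin (n + 1) × Fin q → ℂ} (hw : (hankel s n).mulVec w = 0) :
    (blockRow s (n + 1) n).mulVec w = 0 := by
  set W : Fin (n + 1 + 1) × Fin q → ℂ :=
    fun p => Fin.lastCases (motive := fun _ => ℂ) 0 (fun a => w (a, p.2)) p.1 with hW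
  have hz : ∀ a : Fin (n + 1), ∀ i, (hankel s (n + 1)).mulVec W (a.castSucc, i) = 0 := by
    intro a i
    have := congrFun hw (a, i)
    rw [hankel_mulVec] at this ⊢
    rw [Fin.sum_univ_castSucc]
    have h0 : (fun _ : Fin q => (0 : ℂ)) = 0 := rfl
    simpa [hW, h0] using this
  have hH : (hankel s (n + 1)).mulVec W = 0 := by
    rw [← h.dotProduct_mulVec_zero_iff]
    rw [dotProduct, Fintype.sum_prod_type, Fin.sum_univ_castSucc]
    simp only [hz, mul_zero, Finset.sum_const_zero, zero_add]
    simp [hW]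
  ext i
  have := congrFun hH (Fin.last (n + 1), i)
  rw [hankel_mulVec, Fin.sum_univ_castSucc] at this
  have h0 : (fun _ : Fin q => (0 : ℂ)) = 0 := rfl
  simp [hW, h0] at this
  refine Eq.trans ?_ this
  simp [Matrix.mulVec, dotProduct, blockRow, Fintype.sum_prod_type]

/-- The pivot column is (-H⁺·col, 1). Positivity enters through the kernel inclusion, which gives
H·H⁺·col = col. -/
theorem hasHankelPivot_schurL (hs : ∀ j, (s j).IsHermitian) (h : (hankel s n).PosSemidef) :
    HasHankelPivot s n (schurL s n) := by
  cases n with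
  | zero => exact ⟨1, by simp, by simp [schurL]⟩
  | succ n =>
    have hrow : blockRow s (n + 1) n * (mpInv (hankel s n) * hankel s n) =
        blockRow s (n + 1) n :=
      mul_mpInv_mul_of_ker fun v hv => blockRow_mulVec_eq_zero_of_hankel h hv
    have hEh := hankel_isHermitian hs n
    have hcol : hankel s n * (mpInv (hankel s n) * blockCol s (n + 1) n) =
        blockCol s (n + 1) n := by
      have := congrArg Matrix.conjTranspose hrow
      rw [← blockCol_conjTranspose hs] at this
      simpa [hEh.eq, (mpInv_isHermitian hEh).eq, Matrix.mul_assoc] using this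
    set X := mpInv (hankel s n) * blockCol s (n + 1) n with hX
    set x : ℕ → Matrix (Fin q) (Fin q) ℂ := fun k =>
      if hk : k < n + 1 then -Matrix.of fun a b => X (⟨k, hk⟩, a) b else 1 with hx
    have hxX : X = -blockCol x 0 n := by
      ext ⟨a, i⟩ b
      simp only [blockCol, hx, Matrix.of_apply, Matrix.neg_apply, zero_add]
      rw [dif_pos a.2]
      simp
    refine ⟨x, by simp [hx], fun j hj => ?_⟩
    rw [Finset.sum_range_succ]
    have hx1 : x (n + 1) = 1 := by simp [hx]
    rw [hx1, mul_one]
    split_ifs with hjn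
    · subst hjn
      rw [schurL, Matrix.mul_assoc, ← hX, hxX, Matrix.mul_neg, blockRow_mul_blockCol,
        sub_neg_eq_add, add_comm, two_mul]
    · rw [hxX, Matrix.mul_neg, hankel_mul_blockCol] at hcol
      ext i b
      have := congrFun (congrFun hcol (⟨j, by omega⟩, i)) b
      simp only [blockCol, Matrix.neg_apply, Matrix.of_apply, zero_add] at this
      rw [Matrix.add_apply, add_comm j, ← this, add_neg_cancel, Matrix.zero_apply]

/-- The null space of `s_0` is contained in those of `s_1, …, s_{2n-1}` if `H_n ≥ 0`. -/
theorem mulVec_eq_zero_of_hankel_posSemidef (h : (hankel s n).PosSemidef) {v : Fin q → ℂ}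
    (hv : (s 0).mulVec v = 0) {j : ℕ} (hj : j + 1 ≤ 2 * n ∨ j = 0) : (s j).mulVec v = 0 := by
  have key : ∀ i : Fin (n + 1), (s (2 * i)).mulVec v = 0 →
      ∀ a : Fin (n + 1), (s (a + i)).mulVec v = 0 := by
    intro i hi a
    -- With v placed in block i the quadratic form equals v*·s_{2i}·v = 0, so the whole i-th block
    -- column annihilates v.
    set w : Fin (n + 1) × Fin q → ℂ := fun p => if p.1 = i then v p.2 else 0 with hw
    have hmul : ∀ a : Fin (n + 1), ∀ k,
        (hankel s n).mulVec w (a, k) = (s (a + i)).mulVec v k := by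
      intro a k
      rw [hankel_mulVec, Finset.sum_eq_single i]
      · simp [hw]
      · intro b _ hb
        have h0 : (fun _ : Fin q => (0 : ℂ)) = 0 := rfl
        simp [hw, hb, h0]
      · simp
    have hH : (hankel s n).mulVec w = 0 := by
      rw [← h.dotProduct_mulVec_zero_iff, dotProduct, Fintype.sum_prod_type]
      refine Finset.sum_eq_zero fun a _ => Finset.sum_eq_zero fun k _ => ?_
      rw [hmul]
      by_cases ha : a = i
      · rw [ha, ← two_mul, hi]; simp
      · simp [hw, ha]
    funext k
    rw [← hmul, hH]; rfl
  induction j using Nat.strong_induction_on with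
  | _ j ih =>
    rcases Nat.eq_zero_or_pos j with rfl | hpos
    · exact hv
    · rcases Nat.even_or_odd' j with ⟨c, rfl | rfl⟩
      · have := key ⟨c - 1, by omega⟩ (ih (2 * (c - 1)) (by omega) (by omega)) ⟨c + 1, by omega⟩
        rwa [show c + 1 + (c - 1) = 2 * c by omega] at this
      · have := key ⟨c, by omega⟩ (ih (2 * c) (by omega) (by omega)) ⟨c + 1, by omega⟩
        rwa [show c + 1 + c = 2 * c + 1 by omega] at this

end Hankel

/-! ### Recursions and symmetry of the inverse transform -/

section Transform

variable {q : ℕ}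

theorem invTransform_succ (c : ℂ) (t : ℕ → Matrix (Fin q) (Fin q) ℂ)
    (A : Matrix (Fin q) (Fin q) ℂ) (j : ℕ) :
    invTransform c t A (j + 1) = c • invTransform c t A j + A * mpInv A *
      ∑ k ∈ Finset.range (j + 1), t (j - k) * mpInv A * plusTransform c (invTransform c t A) k := by
  have h : ∀ i, invTransform c t A i = c ^ i • A + ∑ l ∈ Finset.Icc 1 i, c ^ (i - l) •
      (A * mpInv A * ∑ k ∈ Finset.range l,
        t (l - k - 1) * mpInv A * plusTransform c (invTransform c t A) k) := by
    intro i
    cases i with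
    | zero => simp [invTransform_zero]
    | succ i => exact invTransform_eq c t A (i + 1) (by omega)
  rw [h (j + 1), h j, Finset.sum_Icc_succ_top (by omega), smul_add, Finset.smul_sum, smul_smul,
    ← pow_succ', ← add_assoc]
  congr 1
  · congr 1
    refine Finset.sum_congr rfl fun l hl => ?_
    rw [smul_smul, ← pow_succ', show j + 1 - l = j - l + 1 by
      have := Finset.mem_Icc.1 hl; omega]
  · rw [Nat.sub_self, pow_zero, one_smul]
    congr 1
    refine Finset.sum_congr rfl fun k _ => ?_
    rw [show j + 1 - k - 1 = j - k by omega]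

theorem plusTransform_succ_invTransform (c : ℂ) {t : ℕ → Matrix (Fin q) (Fin q) ℂ}
    {A : Matrix (Fin q) (Fin q) ℂ} (ht : ∀ k, A * mpInv A * t k = t k) (j : ℕ) :
    plusTransform c (invTransform c t A) (j + 1) = ∑ b ∈ Finset.range (j + 1),
      t b * (mpInv A * plusTransform c (invTransform c t A) (j - b)) := by
  rw [plusTransform, invTransform_succ, neg_add_cancel_left, Finset.mul_sum,
    ← Finset.sum_range_reflect]
  refine Finset.sum_congr rfl fun k hk => ?_
  have := Finset.mem_range.1 hk
  rw [show j - (j + 1 - 1 - k) = k by omega, show j + 1 - 1 - k = j - k by omega,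
    Matrix.mul_assoc (t k), ← Matrix.mul_assoc, ht]

/-- Coefficient form of cancelling 1 - cX in P = A + X·T·B·P, using (1 - cX)T = t₀ + X·T^c, with T^c
the series of the shifted t. -/
theorem sum_rightShift_mul {c : ℂ} {t s : ℕ → Matrix (Fin q) (Fin q) ℂ}
    {B : Matrix (Fin q) (Fin q) ℂ}
    (h : ∀ k, plusTransform c s (k + 1) =
      ∑ b ∈ Finset.range (k + 1), t b * (B * plusTransform c s (k - b))) (k : ℕ) :
    ∑ b ∈ Finset.range k, rightShift c t b * (B * s (k - 1 - b)) =
      s (k + 1) - c • s k - t 0 * (B * s k) := by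
  have e1 : ∑ b ∈ Finset.range k, t b * (B * plusTransform c s (k - b)) =
      ∑ b ∈ Finset.range k, t b * (B * s (k - b)) -
        c • ∑ b ∈ Finset.range k, t b * (B * s (k - 1 - b)) := by
    rw [Finset.smul_sum, ← Finset.sum_sub_distrib]
    refine Finset.sum_congr rfl fun b hb => ?_
    rw [show k - b = k - 1 - b + 1 by have := Finset.mem_range.1 hb; omega, plusTransform]
    simp only [Matrix.mul_add, Matrix.mul_neg, Matrix.mul_smul]
    abel
  have e2 : ∑ b ∈ Finset.range k, t b * (B * s (k - b)) + t k * (B * s 0) =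
      ∑ b ∈ Finset.range k, t (b + 1) * (B * s (k - 1 - b)) + t 0 * (B * s k) := by
    have := (Finset.sum_range_succ (fun b => t b * (B * s (k - b))) k).symm.trans
      (Finset.sum_range_succ' _ k)
    simp only [Nat.sub_self, Nat.sub_zero] at this
    rw [this]
    congr 1
    exact Finset.sum_congr rfl fun b _ => by rw [show k - (b + 1) = k - 1 - b by omega]
  have e3 : s (k + 1) - c • s k = plusTransform c s (k + 1) := by
    rw [plusTransform]; abel
  rw [e3, h, Finset.sum_range_succ, e1, Nat.sub_self, plusTransform]
  simp only [rightShift, Matrix.add_mul, Matrix.neg_mul, Matrix.smul_mul, Finset.sum_add_distrib,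
    Finset.sum_neg_distrib, ← Finset.smul_sum]
  rw [sub_add_eq_add_sub, e2]
  abel

theorem rightShift_isHermitian {α : ℝ} {s : ℕ → Matrix (Fin q) (Fin q) ℂ}
    (hs : ∀ j, (s j).IsHermitian) (j : ℕ) : (rightShift (α : ℂ) s j).IsHermitian := by
  rw [Matrix.IsHermitian, rightShift, Matrix.conjTranspose_add, Matrix.conjTranspose_neg,
    Matrix.conjTranspose_smul, (hs j).eq, (hs (j + 1)).eq]
  simp

variable {α : ℝ} {t : ℕ → Matrix (Fin q) (Fin q) ℂ} {A : Matrix (Fin q) (Fin q) ℂ}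

theorem mul_mpInv_mul_plusTransform (c : ℂ)
    (h0 : ∀ k, A * mpInv A * t k = t k) (k : ℕ) :
    A * mpInv A * plusTransform c (invTransform c t A) k =
      plusTransform c (invTransform c t A) k := by
  cases k with
  | zero => rw [plusTransform, invTransform_zero, (isMoorePenrose_mpInv A).mul_mul_left]
  | succ k =>
    rw [plusTransform_succ_invTransform c h0, Finset.mul_sum]
    exact Finset.sum_congr rfl fun b _ => by rw [← Matrix.mul_assoc, h0]

theorem mul_mpInv_mul_invTransform (c : ℂ) (k : ℕ) :
    A * mpInv A * invTransform c t A k = invTransform c t A k := by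
  induction k with
  | zero => rw [invTransform_zero, (isMoorePenrose_mpInv A).mul_mul_left]
  | succ k ih =>
    rw [invTransform_succ, Matrix.mul_add, Matrix.mul_smul, ih, ← Matrix.mul_assoc _ (_ * _),
      ← Matrix.mul_assoc _ A, (isMoorePenrose_mpInv A).mul_mul_left]

/-- The conjugate transposes satisfy the right-handed recursion, whose solution agrees with the
left-handed one by `resolvent_left_eq_right`. -/
theorem plusTransform_invTransform_isHermitian (hA : A.IsHermitian)
    (ht : ∀ k, (t k).IsHermitian) (h0 : ∀ k, A * mpInv A * t k = t k) (k : ℕ) :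
    (plusTransform (α : ℂ) (invTransform (α : ℂ) t A) k).IsHermitian := by
  set p := plusTransform (α : ℂ) (invTransform (α : ℂ) t A) with hp
  have hB := mpInv_isHermitian hA
  have hp0 : p 0 = A := by rw [hp, plusTransform, invTransform_zero]
  have h1 : ∀ k, p 0 * mpInv A * p k = p k := by
    rw [hp0]; exact mul_mpInv_mul_plusTransform _ h0
  refine congrFun (resolvent_left_eq_right (p := p) (p' := fun k => (p k).conjTranspose)
    (plusTransform_succ_invTransform _ h0) (fun k => ?_) ?_ h1 fun k => ?_) k
  · rw [hp, plusTransform_succ_invTransform _ h0, Matrix.conjTranspose_sum]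
    refine Finset.sum_congr rfl fun b _ => ?_
    rw [Matrix.conjTranspose_mul, Matrix.conjTranspose_mul, (ht b).eq, hB.eq]
  · simp only [hp0, hA.eq]
  · have := congrArg Matrix.conjTranspose (h1 k)
    rw [Matrix.conjTranspose_mul, Matrix.conjTranspose_mul, hB.eq, hp0, hA.eq,
      ← Matrix.mul_assoc] at this
    rwa [hp0]

theorem invTransform_isHermitian (hA : A.IsHermitian)
    (ht : ∀ k, (t k).IsHermitian) (h0 : ∀ k, A * mpInv A * t k = t k) (k : ℕ) :
    (invTransform (α : ℂ) t A k).IsHermitian := by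
  induction k with
  | zero => rwa [invTransform_zero]
  | succ k ih =>
    have := plusTransform_invTransform_isHermitian (α := α) hA ht h0 (k + 1)
    rw [plusTransform] at this
    have h2 : (((α : ℂ)) • invTransform (α : ℂ) t A k).IsHermitian := by
      rw [Matrix.IsHermitian, Matrix.conjTranspose_smul, ih.eq]
      simp
    simpa using h2.add this

theorem schurL_rightShift_invTransform (hA : A.IsHermitian)
    (ht : ∀ k, (t k).IsHermitian) (h0 : ∀ k, A * mpInv A * t k = t k)
    (h1 : ∀ k, t k * (mpInv A * A) = t k) {n : ℕ} (hn : (hankel t n).PosSemidef) :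
    schurL (rightShift (α : ℂ) (invTransform (α : ℂ) t A)) n = schurL t n := by
  have hs := invTransform_isHermitian (α := α) hA ht h0
  refine schurL_eq_of_hasHankelPivot (rightShift_isHermitian hs) ?_
  have hB := mpInv_isHermitian hA
  set p := plusTransform (α : ℂ) (invTransform (α : ℂ) t A) with hp
  have hpH := plusTransform_invTransform_isHermitian (α := α) hA ht h0
  have hp0 : p 0 = A := by rw [hp, plusTransform, invTransform_zero]
  have hl := plusTransform_succ_invTransform (α : ℂ) h0
  -- `rightShift` of the transform at k is `p (k + 1)` by definition; the right-handed recursion is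
  -- the conjugate transpose of `hl`.
  refine HasHankelPivot.shift (p := p) (B := mpInv A) hl (fun k => ?_) (by rwa [hp0])
    (by rwa [hp0]) (hasHankelPivot_schurL ht hn)
  have := congrArg Matrix.conjTranspose (hl k)
  rw [(hpH _).eq, Matrix.conjTranspose_sum] at this
  rw [hp, this]
  refine Finset.sum_congr rfl fun b _ => ?_
  rw [Matrix.conjTranspose_mul, Matrix.conjTranspose_mul, (ht b).eq, hB.eq, (hpH _).eq]

theorem schurL_succ_invTransform (hA : A.IsHermitian)
    (ht : ∀ k, (t k).IsHermitian) (h0 : ∀ k, A * mpInv A * t k = t k)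
    (h1 : ∀ k, t k * (mpInv A * A) = t k) {n : ℕ}
    (hn : (hankel (rightShift (α : ℂ) t) n).PosSemidef) :
    schurL (invTransform (α : ℂ) t A) (n + 1) = schurL (rightShift (α : ℂ) t) n := by
  have hs := invTransform_isHermitian (α := α) hA ht h0
  have hτ := rightShift_isHermitian (α := α) ht
  refine schurL_eq_of_hasHankelPivot hs ?_
  have hB := mpInv_isHermitian hA
  have hl := sum_rightShift_mul (plusTransform_succ_invTransform (α : ℂ) h0)
  have hs0 := mul_mpInv_mul_invTransform (t := t) (A := A) (α : ℂ)
  refine HasHankelPivot.succ (c := (α : ℂ)) (B := mpInv A) (D := t 0) hl (fun k => ?_)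
    (by rwa [invTransform_zero]) (fun k => ?_) (fun k => ?_) (fun k => ?_)
    (hasHankelPivot_schurL hτ hn)
  · have := congrArg Matrix.conjTranspose (hl k)
    rw [Matrix.conjTranspose_sum] at this
    simp only [Matrix.conjTranspose_sub, Matrix.conjTranspose_mul, Matrix.conjTranspose_smul,
      (hs _).eq, (ht _).eq, hB.eq, (hτ _).eq] at this
    simpa using this
  · have := congrArg Matrix.conjTranspose (hs0 k)
    rw [invTransform_zero]
    rwa [Matrix.conjTranspose_mul, Matrix.conjTranspose_mul, (hs k).eq, hB.eq, hA.eq] at this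
  · rw [invTransform_zero, rightShift, Matrix.mul_add, Matrix.mul_neg, Matrix.mul_smul, h0, h0]
  · rw [invTransform_zero, rightShift, Matrix.add_mul, Matrix.neg_mul, Matrix.smul_mul, h1, h1]

end Transform

/-! ### Dependence on finitely many terms, and Stieltjes-nonnegative sequences -/

section Locality

variable {q : ℕ} {s s' : ℕ → Matrix (Fin q) (Fin q) ℂ}

theorem rightShift_congr (c : ℂ) {j : ℕ} (h : ∀ i ≤ j + 1, s i = s' i) :
    ∀ i ≤ j, rightShift c s i = rightShift c s' i := fun i hi => by
  rw [rightShift, rightShift, h i (by omega), h (i + 1) (by omega)]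

theorem hankel_congr {n : ℕ} (h : ∀ i ≤ 2 * n, s i = s' i) : hankel s n = hankel s' n := by
  ext ⟨a, i⟩ ⟨b, j⟩
  simp only [hankel, Matrix.of_apply]
  rw [h _ (by omega)]

theorem schurL_congr {n : ℕ} (h : ∀ i ≤ 2 * n, s i = s' i) : schurL s n = schurL s' n := by
  cases n with
  | zero => exact h 0 le_rfl
  | succ n =>
    have h1 : blockRow s (n + 1) n = blockRow s' (n + 1) n := by
      ext i ⟨a, j⟩
      simp only [blockRow, Matrix.of_apply]
      rw [h _ (by omega)]
    have h2 : blockCol s (n + 1) n = blockCol s' (n + 1) n := by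
      ext ⟨a, i⟩ j
      simp only [blockCol, Matrix.of_apply]
      rw [h _ (by omega)]
    rw [schurL, schurL, h1, h2, h _ le_rfl, hankel_congr fun i hi => h i (by omega)]

theorem stieltjesParam_congr (c : ℂ) {j : ℕ} (h : ∀ i ≤ j, s i = s' i) :
    stieltjesParam c s j = stieltjesParam c s' j := by
  rcases Nat.even_or_odd' j with ⟨k, rfl | rfl⟩
  · rw [stieltjesParam_even, stieltjesParam_even, schurL_congr h]
  · rw [stieltjesParam_odd, stieltjesParam_odd, schurL_congr (rightShift_congr c h)]

theorem invTransform_congr (c : ℂ) (A : Matrix (Fin q) (Fin q) ℂ) {j : ℕ}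
    (h : ∀ i < j, s i = s' i) : invTransform c s A j = invTransform c s' A j := by
  induction j using Nat.strong_induction_on with
  | _ j ih =>
    cases j with
    | zero => rw [invTransform_zero, invTransform_zero]
    | succ j =>
      have h' : ∀ k ≤ j, invTransform c s A k = invTransform c s' A k := fun k hk =>
        ih k (by omega) fun i hi => h i (by omega)
      rw [invTransform_succ, invTransform_succ, h' j le_rfl]
      congr 2
      refine Finset.sum_congr rfl fun k hk => ?_
      have hk := Finset.mem_range.1 hk
      rw [h (j - k) (by omega)]
      cases k with
      | zero => rw [plusTransform, plusTransform, h' 0 (by omega)]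
      | succ k => rw [plusTransform, plusTransform, h' k (by omega), h' (k + 1) (by omega)]

variable {α : ℝ} {m : ℕ}

theorem IsStieltjesNonneg.congr (h : IsStieltjesNonneg α m s) (hs : ∀ i ≤ m, s i = s' i) :
    IsStieltjesNonneg α m s' := by
  refine ⟨?_, fun hm => ?_⟩
  · rw [← hankel_congr fun i hi => hs i (by omega)]
    exact h.1
  · rw [← hankel_congr (rightShift_congr _ fun i hi => hs i (by omega))]
    exact h.2 hm

theorem IsStieltjesNonneg.of_succ (h : IsStieltjesNonneg α (m + 1) s) :
    IsStieltjesNonneg α m s :=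
  ⟨hankel_posSemidef_of_le h.1 (by omega),
    fun _ => hankel_posSemidef_of_le (h.2 (by omega)) (by omega)⟩

theorem IsStieltjesNonneg.isHermitian (h : IsStieltjesNonneg α m s) {j : ℕ} (hj : j ≤ m) :
    (s j).IsHermitian := by
  by_cases hj' : j ≤ 2 * (m / 2)
  · exact isHermitian_of_hankel_posSemidef h.1 hj'
  · obtain ⟨i, rfl⟩ : ∃ i, j = i + 1 := ⟨j - 1, by omega⟩
    have h1 : (s i).IsHermitian := isHermitian_of_hankel_posSemidef h.1 (by omega)
    have h2 := isHermitian_of_hankel_posSemidef (h.2 (by omega)) (j := i) (by omega)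
    have h3 : ((α : ℂ) • s i).IsHermitian := by
      rw [Matrix.IsHermitian, Matrix.conjTranspose_smul, h1.eq]
      simp
    simpa [rightShift] using h3.add h2

/-- The Hankel matrix of s covers every index except j = m - 1 for odd m ≥ 3; there the Hankel
matrix of the shifted sequence supplies the missing step. -/
theorem IsStieltjesNonneg.mulVec_eq_zero (h : IsStieltjesNonneg α m s) {v : Fin q → ℂ}
    (hv : (s 0).mulVec v = 0) {j : ℕ} (hj : j < m) : (s j).mulVec v = 0 := by
  by_cases hj' : j + 1 ≤ 2 * (m / 2) ∨ j = 0
  · exact mulVec_eq_zero_of_hankel_posSemidef h.1 hv hj'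
  · obtain ⟨i, rfl⟩ : ∃ i, j = i + 1 := ⟨j - 1, by omega⟩
    have h1 : (s 1).mulVec v = 0 := mulVec_eq_zero_of_hankel_posSemidef h.1 hv (by omega)
    have hi : (s i).mulVec v = 0 := mulVec_eq_zero_of_hankel_posSemidef h.1 hv (by omega)
    have h0 : (rightShift (α : ℂ) s 0).mulVec v = 0 := by
      simp [rightShift, Matrix.add_mulVec, Matrix.neg_mulVec, Matrix.smul_mulVec, hv, h1]
    have := mulVec_eq_zero_of_hankel_posSemidef (h.2 (by omega)) h0 (j := i) (by omega)
    simpa [rightShift, Matrix.add_mulVec, Matrix.neg_mulVec, Matrix.smul_mulVec, hi] using this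

theorem stieltjesParam_invTransform {t : ℕ → Matrix (Fin q) (Fin q) ℂ}
    {A : Matrix (Fin q) (Fin q) ℂ} (hA : A.IsHermitian) (h : IsStieltjesNonneg α m t)
    (hker : ∀ v, A.mulVec v = 0 → (t 0).mulVec v = 0 ∧ (t m).mulVec v = 0) {j : ℕ}
    (hj : j ≤ m) :
    stieltjesParam (α : ℂ) (invTransform (α : ℂ) t A) (j + 1) = stieltjesParam (α : ℂ) t j := by
  -- Terms beyond m are unconstrained. Replacing them by 0 makes symmetry and absorption hold at
  -- every index without changing the parameters in question.
  set u : ℕ → Matrix (Fin q) (Fin q) ℂ := fun i => if i ≤ m then t i else 0 with hu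
  have hut : ∀ i ≤ m, t i = u i := fun i hi => by simp [hu, hi]
  have hN := h.congr hut
  rw [stieltjesParam_congr _ (s := t) (s' := u) fun i hi => hut i (by omega),
    stieltjesParam_congr _ fun i hi => invTransform_congr (s := t) (s' := u) (α : ℂ) A
      fun i' hi' => hut i' (by omega)]
  have hH : ∀ i, (u i).IsHermitian := fun i => by
    by_cases hi : i ≤ m
    · exact hN.isHermitian hi
    · simp [hu, hi]
  have h1 : ∀ i, u i * (mpInv A * A) = u i := fun i => by
    by_cases hi : i ≤ m
    · rw [← hut i hi]
      refine mul_mpInv_mul_of_ker fun v hv => ?_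
      rcases hi.lt_or_eq with hi | rfl
      · exact h.mulVec_eq_zero (hker v hv).1 hi
      · exact (hker v hv).2
    · simp [hu, hi]
  have h0 : ∀ i, A * mpInv A * u i = u i := fun i => by
    have := congrArg Matrix.conjTranspose (h1 i)
    rwa [Matrix.conjTranspose_mul, Matrix.conjTranspose_mul, (hH i).eq, hA.eq,
      (mpInv_isHermitian hA).eq] at this
  rcases Nat.even_or_odd' j with ⟨k, rfl | rfl⟩
  · rw [stieltjesParam_even, stieltjesParam_odd]
    exact schurL_rightShift_invTransform hA hH h0 h1
      (hankel_posSemidef_of_le hN.1 (by omega))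
  · rw [stieltjesParam_odd, show 2 * k + 1 + 1 = 2 * (k + 1) by ring, stieltjesParam_even]
    exact schurL_succ_invTransform hA hH h0 h1
      (hankel_posSemidef_of_le (hN.2 (by omega)) (by omega))

end Locality

end StieltjesSchur

theorem theoremT0957 (q : ℕ) (α : ℝ) (t : ℕ → Matrix (Fin q) (Fin q) ℂ)
    (A : Matrix (Fin q) (Fin q) ℂ) (hA : A.PosSemidef) :
    (∀ κ : ℕ∞, StieltjesSchur.IsStieltjesNonnegExt α κ t →
      LinearMap.ker A.mulVecLin ≤ LinearMap.ker (t 0).mulVecLin →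
        StieltjesSchur.stieltjesParam (α : ℂ) (StieltjesSchur.invTransform (α : ℂ) t A) 0 = A ∧
        ∀ j : ℕ, 1 ≤ j → (j : ℕ∞) ≤ κ + 1 →
          StieltjesSchur.stieltjesParam (α : ℂ) (StieltjesSchur.invTransform (α : ℂ) t A) j =
            StieltjesSchur.stieltjesParam (α : ℂ) t (j - 1)) ∧
    (∀ m : ℕ, StieltjesSchur.IsStieltjesNonneg α m t →
      LinearMap.ker A.mulVecLin ≤
        LinearMap.ker (t 0).mulVecLin ⊓ LinearMap.ker (t m).mulVecLin →
        StieltjesSchur.stieltjesParam (α : ℂ) (StieltjesSchur.invTransform (α : ℂ) t A) 0 = A ∧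
        ∀ j : ℕ, 1 ≤ j → j ≤ m + 1 →
          StieltjesSchur.stieltjesParam (α : ℂ) (StieltjesSchur.invTransform (α : ℂ) t A) j =
            StieltjesSchur.stieltjesParam (α : ℂ) t (j - 1)) := by
  have hQ0 : StieltjesSchur.stieltjesParam (α : ℂ)
      (StieltjesSchur.invTransform (α : ℂ) t A) 0 = A := by
    rw [show 0 = 2 * 0 by rfl, StieltjesSchur.stieltjesParam_even, StieltjesSchur.schurL,
      StieltjesSchur.invTransform_zero]
  refine ⟨fun κ hκ hker => ⟨hQ0, fun j hj hjκ => ?_⟩, fun m hm hker => ⟨hQ0, fun j hj hjm => ?_⟩⟩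
  · obtain ⟨i, rfl⟩ : ∃ i, j = i + 1 := ⟨j - 1, by omega⟩
    -- One further term X makes m an interior index, so the kernel condition on `t m` follows from
    -- that on `t 0`; this reduces (a) to the situation of (b).
    have key : ∀ X : Matrix (Fin q) (Fin q) ℂ, ∀ m, i ≤ m →
        StieltjesSchur.IsStieltjesNonneg α (m + 1) (Function.update t (m + 1) X) →
        StieltjesSchur.stieltjesParam (α : ℂ) (StieltjesSchur.invTransform (α : ℂ) t A) (i + 1) =
          StieltjesSchur.stieltjesParam (α : ℂ) t i := by
      intro X m him hX
      have ht : ∀ k ≤ m, Function.update t (m + 1) X k = t k := fun k hk =>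
        Function.update_of_ne (by omega) _ _
      refine StieltjesSchur.stieltjesParam_invTransform hA.isHermitian (hX.of_succ.congr ht)
        (fun v hv => ?_) him
      have hv0 : (t 0).mulVec v = 0 := hker hv
      refine ⟨hv0, ?_⟩
      rw [← ht m le_rfl]
      exact hX.mulVec_eq_zero (by rwa [ht 0 (by omega)]) (by omega)
    cases κ with
    -- An infinite sequence is cut at i and extended by its own next term.
    | top => exact key (t (i + 1)) i le_rfl (by rw [Function.update_eq_self]; exact hκ (i + 1))
    | coe m =>
      obtain ⟨X, hX⟩ := hκ
      exact key X m (by norm_cast at hjκ; omega) hX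
  · obtain ⟨i, rfl⟩ : ∃ i, j = i + 1 := ⟨j - 1, by omega⟩
    exact StieltjesSchur.stieltjesParam_invTransform hA.isHermitian hm
      (fun v hv => ⟨(hker hv).1, (hker hv).2⟩) (by omega)
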